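/- Let $l,n,d$ be positive integers with $n>1$ and $\gcd(l,nd)=d$. For an element $u$ of $\mathrm{GF}(2^{nd})$ (or the variable $x$) write $u_i=u^{2^{il}}$ for $i\ge 0$. Let $\mathrm{Tr}_d^{nd}(u)=\sum_{i=0}^{n-1}u^{2^{id}}$, and define polynomials over $\mathrm{GF}(2^{nd})$ by \[C_1(x)=C_2(x)=1,\qquad C_{i+2}(x)=C_{i+1}(x)+x^{2^{il}}\,C_i(x)\quad (i\ge 1).\] For $v\in\mathrm{GF}(2^{nd})\setminus\mathrm{GF}(2^d)$ let \[V=V(v)=\frac{v_0^{2^{2l}+1}}{(v_0+v_1)^{2^l+1}}.\] (1) For every $v\in\mathrm{GF}(2^{nd})\setminus\mathrm{GF}(2^d)$ the elements $v_0+v_1$ and $v_1+v_2$ are nonzero, and \[C_n(V)=\frac{\mathrm{Tr}_d^{nd}(v_0)}{v_1+v_2}\prod_{j=2}^{n-1}\left(\frac{v_0}{v_0+v_1}\right)^{2^{jl}}\] (the empty product, for $n=2$, is $1$). (2) The number of distinct zeros of $C_n(x)$ in $\mathrm{GF}(2^{nd})$ is $\frac{2^{(n-1)d}-1}{2^{2d}-1}$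 if $n$ is odd and $\frac{2^{(n-1)d}-2^d}{2^{2d}-1}$ if $n$ is even. (3) The zeros of $C_n(x)$ in $\mathrm{GF}(2^{nd})$ are exactly the elements $V(v)$ with $v\in\mathrm{GF}(2^{nd})\setminus\mathrm{GF}(2^d)$ and $\mathrm{Tr}_d^{nd}(v_0)=0$, and each of them has multiplicity exactly $2^l$. (4) $C_n(x)$ splits into linear factors over $\mathrm{GF}(2^{nd})$ if and only if $d=l$ or $n<4$. -/

import Mathlib

open Polynomial

/-- The conjugates `u_i = u ^ (2 ^ (i * l))`; also used for the formal variable `x`. -/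
def conj2 {R : Type*} [Monoid R] (l i : ℕ) (u : R) : R :=
  u ^ (2 ^ (i * l))

/-- The polynomials `C_i(x)`: `C_1 = C_2 = 1` and `C_{i+2} = C_{i+1} + x_i C_i` for `i ≥ 1`,
where `x_i = x ^ (2 ^ (i * l))`. The index `0` is never used. -/
noncomputable def polyC (F : Type*) [Field F] (l : ℕ) : ℕ → F[X]
  | 0 => 0
  | 1 => 1
  | 2 => 1
  | i + 3 => polyC F l (i + 2) + conj2 l (i + 1) (X : F[X]) * polyC F l (i + 1)

/-- The trace `Tr_d^k(x) = ∑_{i=0}^{k/d-1} x ^ (2 ^ (i * d))` from `GF(2^k)` to `GF(2^d)`. -/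
def trGF {F : Type*} [Field F] (d k : ℕ) (x : F) : F :=
  ∑ i ∈ Finset.range (k / d), x ^ (2 ^ (i * d))

/-- `V = v_0 ^ (2 ^ (2 * l) + 1) / (v_0 + v_1) ^ (2 ^ l + 1)`. -/
def valV {F : Type*} [Field F] (l : ℕ) (v : F) : F :=
  conj2 l 0 v ^ (2 ^ (2 * l) + 1) / (conj2 l 0 v + conj2 l 1 v) ^ (2 ^ l + 1)

/-! Write `σ` for `x ↦ x ^ (2 ^ l)`. Since `gcd(l, nd) = d`, it has order `n` and fixed field `K` of
size `q = 2 ^ d`, and `Tr` is the sum over the powers of `σ`. Induction on `i` gives `C_{i+1}(V) * σ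
v` as a partial trace times a product of conjugates of `w = v / (v + σ v)` (`twistedSeq_twistedV`);
hence `V(v)` is a zero of `C_n` iff `Tr v = 0`.

Conversely, let `C_n(b²) = 0`. The recursion then closes up after `n` steps, and averaging over `σ`
produces `x ≠ 0` with `σ b * σ² x = σ x + b * x`. The quotient `w = b * σ x / x` solves `w * (1 + σ
w) = b²`, and multiplicative Hilbert 90 turns `w` into `v` with `V(v) = b²` (`exists_twistedV_eq`).

For the count, `Tr v = 0` means `v = s + σ s`, and `V(v)` is then the cross-ratio of `s, σ s, σ² s,
σ³ s`, which is invariant under Möbius maps over `K`. Its fibres are parametrised by the nonzero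
pairs in `K × K` (`ncard_fibre_twistedV`), so each has `q² - 1` elements; dividing the number of
trace-zero `v ∉ K` by this counts the zeros.

Finally `C_n` is the `2 ^ l`-th power of a polynomial with only simple zeros in the field. Splitting
therefore means that `altGeom (2 ^ l) n`, from the degree, equals `altGeom (2 ^ d) n`, the number of
zeros. -/

/-! ### The recursion for an endomorphism `σ`, and its value at `V` -/

section Twisted

variable {F : Type*} [Field F]

/-- The values `C_i(a)`, with the power map `x ↦ x ^ (2 ^ l)` replaced by an endomorphism `σ`. -/
def twistedSeq (σ : F →+* F) (a : F) : ℕ → F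
  | 0 => 0
  | 1 => 1
  | i + 2 => twistedSeq σ a (i + 1) + (σ ^ i) a * twistedSeq σ a i

lemma twistedSeq_add_two (σ : F →+* F) (a : F) (i : ℕ) :
    twistedSeq σ a (i + 2) = twistedSeq σ a (i + 1) + (σ ^ i) a * twistedSeq σ a i := rfl

lemma twistedSeq_zero_succ (σ : F →+* F) (i : ℕ) : twistedSeq σ 0 (i + 1) = 1 := by
  induction i with
  | zero => rfl
  | succ i ih => rw [twistedSeq_add_two, ih, map_zero, zero_mul, add_zero]

lemma RingHom.pow_succ_apply' (σ : F →+* F) (i : ℕ) (x : F) :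
    σ ((σ ^ i) x) = (σ ^ (i + 1)) x := by
  rw [pow_succ']; rfl

lemma RingHom.pow_succ_apply (σ : F →+* F) (i : ℕ) (x : F) :
    (σ ^ i) (σ x) = (σ ^ (i + 1)) x := by
  rw [pow_succ]; rfl

lemma RingHom.pow_add_apply (σ : F →+* F) (i j : ℕ) (x : F) :
    (σ ^ i) ((σ ^ j) x) = (σ ^ (i + j)) x := by
  rw [pow_add]; rfl

lemma RingHom.pow_zero_apply (σ : F →+* F) (x : F) : (σ ^ 0) x = x := rfl

/-- These are continuants in `σ a, σ² a, …`, which can be expanded from either end. -/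
lemma twistedSeq_left_rec (σ : F →+* F) (a : F) (i : ℕ) :
    twistedSeq σ a (i + 2) = σ (twistedSeq σ a (i + 1)) + σ a * σ (σ (twistedSeq σ a i)) := by
  induction i using Nat.strong_induction_on with
  | _ i ih =>
    match i with
    | 0 => simp [twistedSeq]
    | 1 => simp [twistedSeq]
    | i + 2 =>
      have e1 := ih (i + 1) (by omega)
      have e2 := ih i (by omega)
      have s1 := congrArg σ (twistedSeq_add_two σ a (i + 1))
      have s2 := congrArg (fun x => σ (σ x)) (twistedSeq_add_two σ a i)
      simp only [map_add, map_mul, RingHom.pow_succ_apply'] at s1 s2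
      linear_combination twistedSeq_add_two σ a (i + 2) + e1 + (σ ^ (i + 2)) a * e2 - s1 - σ a * s2

/-- `C_{i+1}` and `σ C_i` solve the same second-order recursion, so their Casoratian picks up one
conjugate of `a` per step; signs vanish in characteristic 2. -/
lemma twistedSeq_casoratian [CharP F 2] (σ : F →+* F) (a : F) (m : ℕ) :
    twistedSeq σ a (m + 2) * σ (twistedSeq σ a m)
      + twistedSeq σ a (m + 1) * σ (twistedSeq σ a (m + 1))
      = ∏ j ∈ Finset.range m, (σ ^ (j + 1)) a := by
  induction m with
  | zero => simp [twistedSeq]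
  | succ m ih =>
    rw [Finset.prod_range_succ, ← ih, twistedSeq_add_two σ a (m + 1)]
    conv_lhs => rw [twistedSeq_add_two σ a m]
    rw [twistedSeq_add_two σ a m]
    simp only [map_add, map_mul, RingHom.pow_succ_apply']
    linear_combination (twistedSeq σ a (m + 1) * σ (twistedSeq σ a (m + 1))
      + (σ ^ m) a * twistedSeq σ a m * σ (twistedSeq σ a (m + 1))) * (CharTwo.two_eq_zero (R := F))

/-- `V` with the power map replaced by an endomorphism `σ`. -/
def twistedV (σ : F →+* F) (v : F) : F :=
  v * σ (σ v) / ((v + σ v) * (σ v + σ (σ v)))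

lemma twistedV_eq [CharP F 2] (σ : F →+* F) {v : F} (hv : v + σ v ≠ 0) :
    twistedV σ v = v / (v + σ v) * (1 + σ (v / (v + σ v))) := by
  have h1 : σ v + σ (σ v) ≠ 0 := by
    rw [← map_add]; exact (_root_.map_ne_zero σ).mpr hv
  rw [twistedV, map_div₀, map_add]
  field_simp
  linear_combination (-v * σ v) * (CharTwo.two_eq_zero (R := F))

lemma map_add_map_ne_zero (σ : F →+* F) {v : F} (hv : v + σ v ≠ 0) (i : ℕ) :
    (σ ^ i) v + (σ ^ (i + 1)) v ≠ 0 := by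
  rw [← RingHom.pow_succ_apply, ← map_add]; exact (_root_.map_ne_zero _).mpr hv

lemma twistedSeq_twistedV [CharP F 2] (σ : F →+* F) {v : F} (hv : v + σ v ≠ 0) (i : ℕ) :
    twistedSeq σ (twistedV σ v) (i + 1) * σ v =
      (∑ j ∈ Finset.range (i + 1), (σ ^ (j + 1)) v) *
        ∏ j ∈ Finset.range i, (σ ^ (j + 1)) (v / (v + σ v)) := by
  induction i using Nat.strong_induction_on with
  | _ i ih =>
    match i with
    | 0 => simp [twistedSeq]
    | 1 =>
      have h := map_add_map_ne_zero σ hv 1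
      simp only [pow_one] at h
      simp only [Finset.sum_range_succ, Finset.prod_range_succ, Finset.sum_range_zero,
        Finset.prod_range_zero, map_div₀, map_add, RingHom.pow_succ_apply]
      have h' : σ v + σ (σ v) ≠ 0 := h
      simp [twistedSeq]
      field_simp
    | i + 2 =>
      rw [twistedSeq_add_two, add_mul, ih (i + 1) (by omega), mul_assoc, ih i (by omega), twistedV]
      simp only [Finset.sum_range_succ _ (i + 2), Finset.sum_range_succ _ (i + 1),
        Finset.prod_range_succ _ (i + 1), Finset.prod_range_succ _ i]
      generalize (∑ j ∈ Finset.range (i + 1), (σ ^ (j + 1)) v) = S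
      generalize (∏ j ∈ Finset.range i, (σ ^ (j + 1)) (v / (v + σ v))) = P
      have h1 := map_add_map_ne_zero σ hv (i + 1)
      -- With `S` and `P` abstracted, the claim is a rational identity in three consecutive
      -- conjugates `a, b, c` of `v`.
      have h2 := map_add_map_ne_zero σ hv (i + 2)
      simp only [map_div₀, map_mul, map_add, RingHom.pow_succ_apply]
      generalize (σ ^ (i + 1)) v = a at *
      generalize (σ ^ (i + 1 + 1)) v = b at *
      generalize (σ ^ (i + 2 + 1)) v = c at *
      field_simp
      linear_combination (P * a * S * c) * (CharTwo.two_eq_zero (R := F))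

end Twisted

/-! ### Hilbert 90 and descent: every zero is a value of `V` -/

section Descent

variable {F : Type*} [Field F]

lemma map_sum_shift (σ : F →+* F) (n : ℕ) (u u' : ℕ → F) (h : ∀ k < n, σ (u k) = u' (k + 1))
    (h0 : u' n = u' 0) :
    σ (∑ k ∈ Finset.range n, u k) = ∑ k ∈ Finset.range n, u' k := by
  have h1 : σ (∑ k ∈ Finset.range n, u k) = ∑ k ∈ Finset.range n, u' (k + 1) := by
    rw [map_sum]
    exact Finset.sum_congr rfl fun k hk => h k (Finset.mem_range.mp hk)
  have h2 := Finset.sum_range_succ u' n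
  rw [Finset.sum_range_succ', h0] at h2
  rw [h1]
  exact add_right_cancel h2

lemma map_prod_shift (σ : F →+* F) {n : ℕ} (hσ : ∀ x, (σ ^ n) x = x) (b : F) :
    ∏ j ∈ Finset.range n, (σ ^ (j + 1)) b = ∏ j ∈ Finset.range n, (σ ^ j) b := by
  by_cases hb : b = 0
  · subst hb; simp
  have h2 := Finset.prod_range_succ (fun j => (σ ^ j) b) n
  rw [Finset.prod_range_succ', hσ, RingHom.pow_zero_apply] at h2
  exact mul_right_cancel₀ hb h2

/-- Multiplicative Hilbert 90 for a cyclic group of powers of `σ`. -/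
lemma exists_map_eq_mul_of_norm_eq_one (σ : F →+* F) {n : ℕ} (hn : 0 < n)
    (hσ : ∀ x, (σ ^ n) x = x)
    (hind : ∀ c : ℕ → F, (∀ t : F, ∑ k ∈ Finset.range n, (σ ^ k) t * c k = 0) →
      ∀ k < n, c k = 0)
    {e : F} (he : ∏ j ∈ Finset.range n, (σ ^ j) e = 1) :
    ∃ v, v ≠ 0 ∧ σ v = e * v := by
  have he0 : e ≠ 0 := by
    rintro rfl
    rw [Finset.prod_eq_zero (Finset.mem_range.mpr hn) (by simp)] at he
    exact zero_ne_one he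
  have hex : ∃ t : F, ∑ k ∈ Finset.range n, (σ ^ k) t * (∏ j ∈ Finset.range k, (σ ^ j) e)⁻¹ ≠ 0 := by
    by_contra! h
    -- The coefficient at `k = 0` is the empty product, so the Lagrange resolvent is not identically
    -- zero.
    simpa using hind (fun k => (∏ j ∈ Finset.range k, (σ ^ j) e)⁻¹) h 0 hn
  obtain ⟨t, ht⟩ := hex
  refine ⟨_, ht, ?_⟩
  rw [Finset.mul_sum]
  apply map_sum_shift σ n _ (fun k => e * ((σ ^ k) t * (∏ j ∈ Finset.range k, (σ ^ j) e)⁻¹))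
  · intro k _
    rw [map_mul, map_inv₀, map_prod, Finset.prod_range_succ']
    simp only [RingHom.pow_succ_apply', RingHom.pow_zero_apply]
    field_simp
  · simp only [hσ, he, Finset.prod_range_zero, RingHom.pow_zero_apply]

/-- The solution of `b₁ y₂ = y₁ + b y₀` obtained by rescaling `twistedSeq`. -/
def scaledSeq (σ : F →+* F) (b : F) (i : ℕ) : F :=
  b * twistedSeq σ (b ^ 2) i / ∏ j ∈ Finset.range i, (σ ^ j) b

lemma scaledSeq_rec (σ : F →+* F) {b : F} (hb : b ≠ 0) (i : ℕ) :
    (σ ^ (i + 1)) b * scaledSeq σ b (i + 2) = scaledSeq σ b (i + 1) + (σ ^ i) b * scaledSeq σ b i := by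
  have hp : ∀ j, (σ ^ j) b ≠ 0 := fun j => (_root_.map_ne_zero _).mpr hb
  have hP : ∏ j ∈ Finset.range i, (σ ^ j) b ≠ 0 := Finset.prod_ne_zero_iff.mpr fun j _ => hp j
  have h1 := hp (i + 1)
  have h0 := hp i
  rw [scaledSeq, scaledSeq, scaledSeq, Finset.prod_range_succ, Finset.prod_range_succ,
    twistedSeq_add_two, map_pow]
  field_simp

variable [CharP F 2]

/-- If `C_n = 0`, comparing the right and left recursions shows that `σ` fixes `C_{n+1}`. The
Casoratian then reads `C_{n+1}² = N(b)²`, and square roots are unique in characteristic 2. -/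
lemma twistedSeq_succ_of_eq_zero (σ : F →+* F) {n : ℕ} (hσ : ∀ x, (σ ^ n) x = x) {b : F}
    (h : twistedSeq σ (b ^ 2) n = 0) :
    twistedSeq σ (b ^ 2) (n + 1) = ∏ j ∈ Finset.range n, (σ ^ j) b := by
  have h1 := twistedSeq_casoratian σ (b ^ 2) n
  have h2 := twistedSeq_left_rec σ (b ^ 2) n
  rw [twistedSeq_add_two, h] at h2
  simp only [mul_zero, add_zero, map_zero] at h2
  rw [h, ← h2, map_zero, mul_zero, zero_add, map_prod_shift σ hσ] at h1
  simp only [map_pow, Finset.prod_pow] at h1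
  rw [← pow_two] at h1
  exact CharTwo.sq_injective h1

/-- The rescaled sequence `X` has period `n` at its initial data: `X n = X 0` and `X (n + 1) = X 1`.
Hence applying `σ` to the twisted average of `X (n - k)` just raises the index by one, and the
recursion for `X` becomes the equation for `x`. -/
lemma exists_semilinear_solution (σ : F →+* F) {n : ℕ} (hn : 0 < n)
    (hσ : ∀ x, (σ ^ n) x = x)
    (hind : ∀ c : ℕ → F, (∀ t : F, ∑ k ∈ Finset.range n, (σ ^ k) t * c k = 0) →
      ∀ k < n, c k = 0)
    {b : F} (hb : b ≠ 0) (h : twistedSeq σ (b ^ 2) n = 0) :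
    ∃ x, x ≠ 0 ∧ σ b * σ (σ x) = σ x + b * x := by
  have hp : ∏ j ∈ Finset.range n, (σ ^ j) b ≠ 0 :=
    Finset.prod_ne_zero_iff.mpr fun j _ => (_root_.map_ne_zero _).mpr hb
  set X := scaledSeq σ b with hX
  have hX0 : X 0 = 0 := by simp [hX, scaledSeq, twistedSeq]
  have hX1 : X 1 = 1 := by simp [hX, scaledSeq, twistedSeq, hb]
  have hXn : X n = 0 := by simp [hX, scaledSeq, h]
  have hXn1 : X (n + 1) = 1 := by
    rw [hX, scaledSeq, twistedSeq_succ_of_eq_zero σ hσ h, Finset.prod_range_succ, hσ]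
    field_simp
  have hXn2 : X (n + 2) = X 2 := by
    have e1 := scaledSeq_rec σ hb n
    have e2 := scaledSeq_rec σ hb 0
    rw [← hX] at e1 e2
    rw [← RingHom.pow_succ_apply, hσ, hXn, hXn1] at e1
    simp only [zero_add, pow_one, hX0, hX1] at e2
    rw [mul_zero] at e1 e2
    exact mul_left_cancel₀ ((_root_.map_ne_zero σ).mpr hb) (e1.trans e2.symm)
  have hex : ∃ t : F, ∑ k ∈ Finset.range n, (σ ^ k) t * (σ ^ k) (X (n - k)) ≠ 0 := by
    by_contra! h
    -- At `k = n - 1` the coefficient is a conjugate of `X 1 = 1`.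
    have := hind (fun k => (σ ^ k) (X (n - k))) h (n - 1) (by omega)
    simp [show n - (n - 1) = 1 by omega, hX1] at this
  obtain ⟨t, ht⟩ := hex
  refine ⟨_, ht, ?_⟩
  have e1 : σ (∑ k ∈ Finset.range n, (σ ^ k) t * (σ ^ k) (X (n - k))) =
      ∑ k ∈ Finset.range n, (σ ^ k) t * (σ ^ k) (X (n + 1 - k)) := by
    apply map_sum_shift σ n _ (fun k => (σ ^ k) t * (σ ^ k) (X (n + 1 - k)))
    · intro k _
      rw [map_mul, RingHom.pow_succ_apply', RingHom.pow_succ_apply', Nat.add_sub_add_right]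
    · simp [hσ, hX1, hXn1]
  have e2 : σ (∑ k ∈ Finset.range n, (σ ^ k) t * (σ ^ k) (X (n + 1 - k))) =
      ∑ k ∈ Finset.range n, (σ ^ k) t * (σ ^ k) (X (n + 2 - k)) := by
    apply map_sum_shift σ n _ (fun k => (σ ^ k) t * (σ ^ k) (X (n + 2 - k)))
    · intro k _
      rw [map_mul, RingHom.pow_succ_apply', RingHom.pow_succ_apply',
        show n + 2 - (k + 1) = n + 1 - k by omega]
    · simp [hσ, hXn2]
  rw [e1, e2, Finset.mul_sum, Finset.mul_sum, ← Finset.sum_add_distrib]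
  refine Finset.sum_congr rfl fun k hk => ?_
  have hk' := Finset.mem_range.mp hk
  have e := congrArg (σ ^ k) (scaledSeq_rec σ hb (n - k))
  rw [← hX, map_add, map_mul, map_mul, RingHom.pow_add_apply, RingHom.pow_add_apply,
    show k + (n - k + 1) = n + 1 by omega, show k + (n - k) = n by omega, hσ,
    ← RingHom.pow_succ_apply, hσ] at e
  rw [show n + 2 - k = n - k + 2 by omega, show n + 1 - k = n - k + 1 by omega]
  linear_combination (σ ^ k) t * e

/-- Every zero of `C_n` is of the form `V(v)`. -/
lemma exists_twistedV_eq (σ : F →+* F) {n : ℕ} (hn : 0 < n)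
    (hσ : ∀ x, (σ ^ n) x = x)
    (hind : ∀ c : ℕ → F, (∀ t : F, ∑ k ∈ Finset.range n, (σ ^ k) t * c k = 0) →
      ∀ k < n, c k = 0)
    {b : F} (hb : b ≠ 0) (h : twistedSeq σ (b ^ 2) n = 0) :
    ∃ v, v + σ v ≠ 0 ∧ twistedV σ v = b ^ 2 := by
  obtain ⟨x, hx, hrec⟩ := exists_semilinear_solution σ hn hσ hind hb h
  have hσx : σ x ≠ 0 := (_root_.map_ne_zero σ).mpr hx
  set w := b * σ x / x with hw
  have hw0 : w ≠ 0 := div_ne_zero (mul_ne_zero hb hσx) hx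
  have hσw : σ w = 1 + b * x / σ x := by
    rw [hw, map_div₀, map_mul, hrec]; field_simp
  have hwV : w * (1 + σ w) = b ^ 2 := by
    rw [hσw, ← add_assoc, CharTwo.add_self_eq_zero, hw]; field_simp; ring
  have hw1 : 1 + w ≠ 0 := by
    intro h1
    have : 1 + σ w = 0 := by simpa using congrArg σ h1
    rw [this, mul_zero] at hwV
    exact pow_ne_zero 2 hb hwV.symm
  have hN : ∏ j ∈ Finset.range n, (σ ^ j) w = ∏ j ∈ Finset.range n, (σ ^ j) b := by
    have e := map_prod_shift σ hσ x
    have hp : ∏ j ∈ Finset.range n, (σ ^ j) x ≠ 0 :=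
      Finset.prod_ne_zero_iff.mpr fun j _ => (_root_.map_ne_zero _).mpr hx
    simp only [hw, map_div₀, map_mul, Finset.prod_div_distrib, Finset.prod_mul_distrib,
      RingHom.pow_succ_apply, e]
    field_simp
  have hpb : ∏ j ∈ Finset.range n, (σ ^ j) b ≠ 0 :=
    Finset.prod_ne_zero_iff.mpr fun j _ => (_root_.map_ne_zero _).mpr hb
  -- Taking norms in `w * (1 + σ w) = b²` gives `N(w) * N(1 + w) = N(b)²`, where `N(w) = N(b)`.
  have hN1 : ∏ j ∈ Finset.range n, (σ ^ j) (1 + w) = ∏ j ∈ Finset.range n, (σ ^ j) b := by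
    have e : ∏ j ∈ Finset.range n, (σ ^ j) (w * σ (1 + w)) = ∏ j ∈ Finset.range n, (σ ^ j) (b ^ 2) := by
      rw [map_add, map_one, hwV]
    simp only [map_mul, map_pow, Finset.prod_mul_distrib, Finset.prod_pow, hN,
      RingHom.pow_succ_apply, map_prod_shift σ hσ (1 + w)] at e
    rw [pow_two] at e
    exact mul_left_cancel₀ hpb e
  have he : ∏ j ∈ Finset.range n, (σ ^ j) ((1 + w) / w) = 1 := by
    simp only [map_div₀, Finset.prod_div_distrib, hN1, hN]
    exact div_self hpb
  obtain ⟨v, hv0, hv⟩ := exists_map_eq_mul_of_norm_eq_one σ hn hσ hind he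
  have hsum : v + σ v = v / w := by
    rw [hv]; field_simp
    linear_combination w * (CharTwo.two_eq_zero (R := F))
  have hne : v + σ v ≠ 0 := by rw [hsum]; exact div_ne_zero hv0 hw0
  refine ⟨v, hne, ?_⟩
  rw [twistedV_eq σ hne, hsum, ← hwV, div_div_cancel₀ hv0]

end Descent

/-! ### Möbius invariance and the fibres of `V` -/

section Fibre

variable {F : Type*} [Field F] [CharP F 2]

lemma pencil_ne_zero (σ : F →+* F) {s α β : F} (hs : s + σ s ≠ 0) (hα : σ α = α) (hβ : σ β = β)
    (h : α ≠ 0 ∨ β ≠ 0) : α * s + β ≠ 0 := by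
  intro h0
  have h1 : α * σ s + β = 0 := by simpa [hα, hβ] using congrArg σ h0
  have h2 : α * (s + σ s) = 0 := by
    linear_combination h0 + h1 - β * (CharTwo.two_eq_zero (R := F))
  have hα0 : α = 0 := (mul_eq_zero.mp h2).resolve_right hs
  rw [hα0, zero_mul, zero_add] at h0
  exact h.elim (· hα0) (· h0)

/-- The Möbius action on `s`, in terms of `v = s + σ s`. -/
def mobiusTwist (σ : F →+* F) (s α β : F) : F :=
  (s + σ s) / ((α * s + β) * σ (α * s + β))

variable (σ : F →+* F) {s α β : F}

/-- With `y = α * s + β` and `v = s + σ s`, one has `σ y = y + α * v`; this makes the numerator `v *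
σ² y + σ v * y` collapse to `(v + σ v) * σ y`. -/
lemma mobiusTwist_add_map (hs : s + σ s ≠ 0) (hα : σ α = α) (hβ : σ β = β) (h : α ≠ 0 ∨ β ≠ 0) :
    mobiusTwist σ s α β + σ (mobiusTwist σ s α β) =
      (s + σ s + σ (s + σ s)) / ((α * s + β) * σ (σ (α * s + β))) := by
  have h0 := pencil_ne_zero σ hs hα hβ h
  have h1 := (_root_.map_ne_zero σ).mpr h0
  have h2 := (_root_.map_ne_zero σ).mpr h1
  have r0 : σ (α * s + β) = α * s + β + α * (s + σ s) := by
    rw [map_add, map_mul, hα, hβ]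
    linear_combination -(α * s) * (CharTwo.two_eq_zero (R := F))
  have r1 : σ (σ (α * s + β)) = σ (α * s + β) + α * σ (s + σ s) := by
    rw [r0, map_add, map_mul, hα, r0]
  rw [mobiusTwist, map_div₀, map_mul]
  generalize α * s + β = y at *
  generalize s + σ s = v at *
  generalize σ (σ y) = y2 at *
  generalize σ y = y1 at *
  field_simp
  linear_combination v * r1 - σ v * r0

lemma mobiusTwist_add_map_ne_zero (hs : s + σ s ≠ 0) (hs' : s + σ s + σ (s + σ s) ≠ 0)
    (hα : σ α = α) (hβ : σ β = β) (h : α ≠ 0 ∨ β ≠ 0) :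
    mobiusTwist σ s α β + σ (mobiusTwist σ s α β) ≠ 0 := by
  have h0 := pencil_ne_zero σ hs hα hβ h
  have h1 := (_root_.map_ne_zero σ).mpr h0
  have h2 := (_root_.map_ne_zero σ).mpr h1
  rw [mobiusTwist_add_map σ hs hα hβ h]
  exact div_ne_zero hs' (mul_ne_zero h0 h2)

lemma twistedV_mobiusTwist (hs : s + σ s ≠ 0) (hs' : s + σ s + σ (s + σ s) ≠ 0)
    (hα : σ α = α) (hβ : σ β = β) (h : α ≠ 0 ∨ β ≠ 0) :
    twistedV σ (mobiusTwist σ s α β) = twistedV σ (s + σ s) := by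
  have h0 := pencil_ne_zero σ hs hα hβ h
  have h1 := (_root_.map_ne_zero σ).mpr h0
  have h2 := (_root_.map_ne_zero σ).mpr h1
  have h3 := (_root_.map_ne_zero σ).mpr h2
  have hs1 := (_root_.map_ne_zero σ).mpr hs'
  rw [twistedV, twistedV, ← map_add, mobiusTwist_add_map σ hs hα hβ h, ← map_add, mobiusTwist]
  simp only [map_div₀]
  rw [map_mul σ (α * s + β), map_mul σ (α * s + β), map_mul σ (σ (α * s + β))]
  generalize α * s + β = y at *
  generalize s + σ s = v at *
  field_simp

/-- Equality forces `y * σ y = y' * σ y'`, so `y / y'` is fixed by `σ²`. As `s ≠ σ² s`, the pairs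
`(α, β)` and `(α', β')` are proportional, and comparing once more gives equal squares. -/
lemma mobiusTwist_injective (hs : s + σ s ≠ 0) (hs' : s + σ s + σ (s + σ s) ≠ 0)
    (hα : σ α = α) (hβ : σ β = β) (h : α ≠ 0 ∨ β ≠ 0) {α' β' : F}
    (hα' : σ α' = α') (hβ' : σ β' = β') (h' : α' ≠ 0 ∨ β' ≠ 0)
    (heq : mobiusTwist σ s α β = mobiusTwist σ s α' β') : α = α' ∧ β = β' := by
  have h0 := pencil_ne_zero σ hs hα hβ h
  have h1 := (_root_.map_ne_zero σ).mpr h0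
  have h2 := (_root_.map_ne_zero σ).mpr h1
  have h0' := pencil_ne_zero σ hs hα' hβ' h'
  have h1' := (_root_.map_ne_zero σ).mpr h0'
  have h2' := (_root_.map_ne_zero σ).mpr h1'
  have e1 : (α * s + β) * σ (α * s + β) = (α' * s + β') * σ (α' * s + β') := by
    rw [mobiusTwist, mobiusTwist] at heq
    rw [div_eq_div_iff (mul_ne_zero h0 h1) (mul_ne_zero h0' h1')] at heq
    exact (mul_left_cancel₀ hs heq).symm
  have e2 : σ (α * s + β) * σ (σ (α * s + β)) = σ (α' * s + β') * σ (σ (α' * s + β')) := by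
    simpa only [map_mul] using congrArg σ e1
  have e3 : (α * s + β) * σ (σ (α' * s + β')) = (α' * s + β') * σ (σ (α * s + β)) := by
    apply mul_right_cancel₀ (mul_ne_zero h1 h1')
    linear_combination σ (α' * s + β') * σ (σ (α' * s + β')) * e1 - (α' * s + β') * σ (α' * s + β') * e2
  have hss : s + σ (σ s) ≠ 0 := by
    rw [map_add] at hs'
    intro h3
    apply hs'
    linear_combination h3 + σ s * (CharTwo.two_eq_zero (R := F))
  have hdet : α * β' = α' * β := by
    apply mul_right_cancel₀ hss
    simp only [map_add, map_mul, hα, hβ, hα', hβ'] at e3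
    linear_combination e3 + (α * β' * σ (σ s) - α' * β * σ (σ s)) * (CharTwo.two_eq_zero (R := F))
  simp only [map_add, map_mul, hα, hβ, hα', hβ'] at e1 h1 h1'
  have key : α ^ 2 = α' ^ 2 ∧ β ^ 2 = β' ^ 2 := by
    have hq : (α' * s + β') * (α' * σ s + β') ≠ 0 := mul_ne_zero h0' h1'
    constructor
    · apply mul_right_cancel₀ hq
      linear_combination (α' ^ 2) * e1 + (α * α' * (s + σ s) + α * β' + α' * β) * hdet
    · apply mul_right_cancel₀ hq
      linear_combination (β' ^ 2) * e1 - (β * β' * (s + σ s) + (α * β' + α' * β) * s * σ s) * hdet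
  exact ⟨CharTwo.sq_injective key.1, CharTwo.sq_injective key.2⟩

lemma exists_fixed_sqrt [Finite F] {x : F} (hx : σ x = x) : ∃ y, σ y = y ∧ y ^ 2 = x := by
  obtain ⟨y, hy⟩ := (Finite.injective_iff_surjective.mp (CharTwo.sq_injective (R := F))) x
  refine ⟨y, ?_, hy⟩
  apply CharTwo.sq_injective (R := F)
  simp only at hy ⊢
  rw [← map_pow, hy, hx]

/-- The ratio determines `σ v / v`, so `v / v'` is fixed by `σ`; `β` is its square root. -/
lemma exists_eq_div_sq_of_ratio_eq [Finite F] {v v' : F} (hv0 : v ≠ 0) (hv0' : v' ≠ 0)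
    (hv : v + σ v ≠ 0) (hv' : v' + σ v' ≠ 0) (h : v / (v + σ v) = v' / (v' + σ v')) :
    ∃ β, β ≠ 0 ∧ σ β = β ∧ v' = v / β ^ 2 := by
  have hσ' : σ v' ≠ 0 := (_root_.map_ne_zero σ).mpr hv0'
  have h1 : σ (v / v') = v / v' := by
    rw [map_div₀]
    rw [div_eq_div_iff hv hv'] at h
    rw [div_eq_div_iff hσ' hv0']
    linear_combination -h
  obtain ⟨y, hy, hy2⟩ := exists_fixed_sqrt σ h1
  have hyne : y ≠ 0 := by
    rintro rfl
    exact div_ne_zero hv0 hv0' (by simpa using hy2.symm)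
  refine ⟨y, hyne, hy, ?_⟩
  rw [hy2]; field_simp

lemma exists_mobiusTwist_eq [Finite F] (hs : s + σ s ≠ 0) (hs' : s + σ s + σ (s + σ s) ≠ 0)
    {v' : F} (hv' : v' + σ v' ≠ 0) (h : twistedV σ v' = twistedV σ (s + σ s)) :
    ∃ α β, σ α = α ∧ σ β = β ∧ (α ≠ 0 ∨ β ≠ 0) ∧ v' = mobiusTwist σ s α β := by
  have hv0' : v' ≠ 0 := by rintro rfl; simp at hv'
  by_cases hw : (s + σ s) / (s + σ s + σ (s + σ s)) = v' / (v' + σ v')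
  · obtain ⟨β, hβ0, hβ, e⟩ := exists_eq_div_sq_of_ratio_eq σ hs hv0' hs' hv' hw
    exact ⟨0, β, map_zero σ, hβ, Or.inr hβ0, by rw [e, mobiusTwist]; simp [hβ, pow_two]⟩
  rw [twistedV_eq σ hv', twistedV_eq σ hs'] at h
  set w := (s + σ s) / (s + σ s + σ (s + σ s)) with hwdef
  set w' := v' / (v' + σ v') with hwdef'
  have hd : w + w' ≠ 0 := fun h => hw (CharTwo.add_eq_zero.mp h)
  have hd1 : σ w + σ w' ≠ 0 := by rw [← map_add]; exact (_root_.map_ne_zero σ).mpr hd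
  have hw0 : w ≠ 0 := div_ne_zero hs hs'
  have haff : w / (w + w') + (1 + σ w) / (σ w + σ w') = 1 := by
    clear_value w w'
    field_simp
    linear_combination h + (w + w * σ w - w' * σ w') * (CharTwo.two_eq_zero (R := F))
  have hw1 : w * (s + σ s + σ (s + σ s)) = s + σ s := div_mul_cancel₀ _ hs'
  -- Normalise `α = 1` and set `y = s + κ`, `g = σ y`. The ratio attached to the twist is `w * σ g /
  -- g`, which must be `w'`, while `g + σ g = σ (s + σ s)`; solving gives this `g`, and `κ = g + σ
  -- s`.
  set g := w * σ (s + σ s) / (w + w') with hg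
  have hg1 : g + σ g = σ (s + σ s) := by
    have e1 : g = σ (s + σ s) * (w / (w + w')) := by
      rw [hg]; ring
    have e2 : σ g = σ (s + σ s) * ((1 + σ w) / (σ w + σ w')) := by
      have e3 := congrArg σ hw1
      rw [map_mul, map_add] at e3
      rw [hg, map_div₀, map_mul, map_add σ w]
      rw [← mul_div_assoc]
      congr 1
      linear_combination e3 - σ w * σ (s + σ s) * (CharTwo.two_eq_zero (R := F))
    rw [e2, e1, ← mul_add, haff, mul_one]
  have hκ : σ (g + σ s) = g + σ s := by
    rw [map_add] at hg1 ⊢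
    linear_combination hg1 + (σ (σ s) - g) * (CharTwo.two_eq_zero (R := F))
  have hgs : σ (1 * s + (g + σ s)) = g := by
    rw [one_mul, map_add, hκ]
    linear_combination σ s * (CharTwo.two_eq_zero (R := F))
  have h1 : (1 : F) ≠ 0 ∨ g + σ s ≠ 0 := Or.inl one_ne_zero
  have hy := pencil_ne_zero σ hs (map_one σ) hκ h1
  have hg0 : g ≠ 0 := by rw [← hgs]; exact (_root_.map_ne_zero σ).mpr hy
  have hm := mobiusTwist_add_map σ hs (map_one σ) hκ h1
  have hm0 := mobiusTwist_add_map_ne_zero σ hs hs' (map_one σ) hκ h1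
  have hratio : mobiusTwist σ s 1 (g + σ s) /
      (mobiusTwist σ s 1 (g + σ s) + σ (mobiusTwist σ s 1 (g + σ s))) = v' / (v' + σ v') := by
    rw [hm, mobiusTwist, hgs, ← hwdef']
    have hw' : w' * g = w * σ g := by
      have e : g * (w + w') = w * σ (s + σ s) := div_mul_cancel₀ _ hd
      linear_combination e - w * hg1
    generalize 1 * s + (g + σ s) = y at *
    generalize s + σ s = v at *
    clear_value w w' g
    field_simp
    linear_combination -σ g * hw1 - (v + σ v) * hw'
  have hmne : mobiusTwist σ s 1 (g + σ s) ≠ 0 := by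
    rw [mobiusTwist, hgs]; exact div_ne_zero hs (mul_ne_zero hy hg0)
  -- Equal ratios leave only a scalar `β` to adjust.
  obtain ⟨β, hβ0, hβ, e⟩ := exists_eq_div_sq_of_ratio_eq σ hmne hv0' hm0 hv' hratio
  refine ⟨β, β * (g + σ s), hβ, by rw [map_mul, hβ, hκ], Or.inl hβ0, ?_⟩
  rw [e, mobiusTwist, mobiusTwist, show β * s + β * (g + σ s) = β * (1 * s + (g + σ s)) by ring,
    map_mul, hβ, hgs]
  field_simp

end Fibre

/-! ### Sizes of the fibres of `V` and of the image of `s ↦ s + σ s` -/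

section FibreCard

variable {F : Type*} [Field F] [CharP F 2]

lemma ncard_fibre_twistedV [Finite F] (σ : F →+* F) (K : Subfield F) (hK : ∀ x, x ∈ K ↔ σ x = x) {s : F}
    (hs : s + σ s ≠ 0) (hs' : s + σ s + σ (s + σ s) ≠ 0) :
    {v : F | v + σ v ≠ 0 ∧ twistedV σ v = twistedV σ (s + σ s)}.ncard = Nat.card K ^ 2 - 1 := by
  have hfix : ∀ x : K, σ x = x := fun x => (hK x).mp x.2
  have hor : ∀ p : K × K, p ≠ 0 → ((p.1 : F) ≠ 0 ∨ (p.2 : F) ≠ 0) := by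
    intro p hp
    by_contra! h
    exact hp (Prod.ext (Subtype.ext h.1) (Subtype.ext h.2))
  have himg : {v : F | v + σ v ≠ 0 ∧ twistedV σ v = twistedV σ (s + σ s)} =
      (fun p : K × K => mobiusTwist σ s p.1 p.2) '' ({0}ᶜ : Set (K × K)) := by
    ext v
    simp only [Set.mem_ofPred_eq, Set.mem_image, Set.mem_compl_iff, Set.mem_singleton_iff]
    constructor
    · rintro ⟨hv, h⟩
      obtain ⟨α, β, hα, hβ, hne, e⟩ := exists_mobiusTwist_eq σ hs hs' hv h
      refine ⟨(⟨α, (hK α).mpr hα⟩, ⟨β, (hK β).mpr hβ⟩), ?_, e.symm⟩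
      intro h0
      have h1 := congrArg (fun p : K × K => (p.1 : F)) h0
      have h2 := congrArg (fun p : K × K => (p.2 : F)) h0
      simp only [Prod.fst_zero, Prod.snd_zero, ZeroMemClass.coe_zero] at h1 h2
      exact hne.elim (· h1) (· h2)
    · rintro ⟨p, hp, rfl⟩
      exact ⟨mobiusTwist_add_map_ne_zero σ hs hs' (hfix _) (hfix _) (hor p hp),
        twistedV_mobiusTwist σ hs hs' (hfix _) (hfix _) (hor p hp)⟩
  rw [himg, Set.InjOn.ncard_image, Set.ncard_compl, Set.ncard_singleton, Nat.card_prod, pow_two]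
  intro p hp p' hp' h
  have := mobiusTwist_injective σ hs hs' (hfix _) (hfix _) (hor p hp) (hfix _) (hfix _)
    (hor p' hp') h
  exact Prod.ext (Subtype.ext this.1) (Subtype.ext this.2)

lemma ncard_range_add_map (σ : F →+* F) (K : Subfield F) (hK : ∀ x, x ∈ K ↔ σ x = x) :
    Nat.card K * (Set.range fun s => s + σ s).ncard = Nat.card F := by
  let f : F →+ F := AddMonoidHom.id F + (σ : F →+ F)
  have h1 := AddSubgroup.card_eq_card_quotient_mul_card_addSubgroup f.ker
  have h2 : Nat.card (F ⧸ f.ker) = (Set.range fun s => s + σ s).ncard :=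
    Nat.card_congr (QuotientAddGroup.quotientKerEquivRange f).toEquiv
  have h3 : Nat.card f.ker = Nat.card K := by
    refine Nat.card_congr (Equiv.subtypeEquivRight fun x => ?_)
    rw [hK]
    change x + σ x = 0 ↔ _
    rw [CharTwo.add_eq_zero, eq_comm]
  rw [h1, h2, h3, mul_comm]

end FibreCard

/-! ### Fixed points of iterated squaring -/

section FrobeniusPowers

variable {F : Type*} [Field F]

lemma ncard_pow_two_pow_eq_le [Finite F] {m : ℕ} (hm : 0 < m) :
    {x : F | x ^ 2 ^ m = x}.ncard ≤ 2 ^ m := by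
  classical
  have hne : (X ^ 2 ^ m - X : F[X]) ≠ 0 := FiniteField.X_pow_card_pow_sub_X_ne_zero F hm.ne' one_lt_two
  have hsub : {x : F | x ^ 2 ^ m = x} ⊆ ((X ^ 2 ^ m - X : F[X]).roots.toFinset : Set F) := by
    intro x hx
    simp only [Set.mem_ofPred_eq] at hx
    simp [hne, hx]
  calc _ ≤ ((X ^ 2 ^ m - X : F[X]).roots.toFinset : Set F).ncard := Set.ncard_le_ncard hsub
    _ = (X ^ 2 ^ m - X : F[X]).roots.toFinset.card := Set.ncard_coe_finset _
    _ ≤ (X ^ 2 ^ m - X : F[X]).roots.card := Multiset.toFinset_card_le _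
    _ ≤ (X ^ 2 ^ m - X : F[X]).natDegree := card_roots' _
    _ = 2 ^ m := FiniteField.X_pow_card_pow_sub_X_natDegree_eq F hm.ne' one_lt_two

lemma pow_two_pow_gcd {x : F} {m k : ℕ} (hm : x ^ 2 ^ m = x) (hk : x ^ 2 ^ k = x) :
    x ^ 2 ^ m.gcd k = x := by
  have key : ∀ j, ((fun y : F => y ^ 2)^[j]) x = x ^ 2 ^ j := by
    intro j
    induction j with
    | zero => simp
    | succ j ih => rw [Function.iterate_succ_apply', ih, ← pow_mul, pow_succ]
  have h : Function.IsPeriodicPt (fun y : F => y ^ 2) (m.gcd k) x :=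
    Function.IsPeriodicPt.gcd (by rw [Function.IsPeriodicPt, Function.IsFixedPt, key, hm])
      (by rw [Function.IsPeriodicPt, Function.IsFixedPt, key, hk])
  rwa [Function.IsPeriodicPt, Function.IsFixedPt, key] at h

lemma pow_two_pow_mul {x : F} {m : ℕ} (hm : x ^ 2 ^ m = x) (k : ℕ) : x ^ 2 ^ (k * m) = x := by
  induction k with
  | zero => simp
  | succ k ih => rw [Nat.succ_mul, pow_add, pow_mul, ih, hm]

end FrobeniusPowers

/-- The power map `x ↦ x ^ (2 ^ l)` as a ring endomorphism. -/
abbrev frobPow (F : Type*) [Field F] [CharP F 2] (l : ℕ) : F →+* F := iterateFrobenius F 2 l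

/-! ### Specialisation to `σ = x ↦ x ^ (2 ^ l)` on `GF(2^{nd})` -/

section Setup

variable {F : Type*} [Field F] [CharP F 2]

lemma frobPow_pow_apply (l i : ℕ) (x : F) : (frobPow F l ^ i) x = x ^ 2 ^ (i * l) := by
  induction i with
  | zero => simp
  | succ i ih =>
    rw [← RingHom.pow_succ_apply', ih, iterateFrobenius_def, ← pow_mul, ← pow_add]
    congr 2; ring

lemma conj2_eq (l i : ℕ) (x : F) : conj2 l i x = (frobPow F l ^ i) x := (frobPow_pow_apply l i x).symm

lemma conj2_zero_eq {R : Type*} [Monoid R] (l : ℕ) (x : R) : conj2 l 0 x = x := by simp [conj2]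

lemma valV_eq (l : ℕ) (v : F) : valV l v = twistedV (frobPow F l) v := by
  rw [valV, twistedV, conj2_zero_eq, conj2_eq, pow_one, ← map_add, iterateFrobenius_def,
    iterateFrobenius_def, iterateFrobenius_def, pow_succ, pow_succ, ← pow_mul, ← pow_add, ← two_mul]
  ring

lemma eval_polyC (l n : ℕ) (a : F) :
    (polyC F l n).eval a = twistedSeq (frobPow F l) a n := by
  induction n using Nat.strong_induction_on with
  | _ n ih =>
    match n with
    | 0 => simp [polyC, twistedSeq]
    | 1 => simp [polyC, twistedSeq]
    | 2 => simp [polyC, twistedSeq]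
    | n + 3 =>
      rw [polyC, eval_add, eval_mul, ih (n + 2) (by omega), ih (n + 1) (by omega),
        twistedSeq_add_two _ _ (n + 1), ← conj2_eq, conj2, conj2, eval_pow, eval_X]

variable {l n d : ℕ}

lemma frobPow_pow_eq_self (hd : d = Nat.gcd l (n * d)) (hF : Nat.card F = 2 ^ (n * d))
    (x : F) : (frobPow F l ^ n) x = x := by
  have hfin : Finite F := Nat.finite_of_card_ne_zero (by rw [hF]; positivity)
  have := Fintype.ofFinite F
  obtain ⟨l', hl'⟩ : d ∣ l := by rw [hd]; exact Nat.gcd_dvd_left _ _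
  rw [frobPow_pow_apply, show n * l = l' * (n * d) by rw [hl']; ring]
  apply pow_two_pow_mul
  rw [← hF, Nat.card_eq_fintype_card, FiniteField.pow_card]

lemma mem_iff_frobPow_eq (hd0 : 0 < d) (hd : d = Nat.gcd l (n * d)) (hF : Nat.card F = 2 ^ (n * d))
    (K : Subfield F) (hK : Nat.card K = 2 ^ d) (x : F) : x ∈ K ↔ frobPow F l x = x := by
  have hfin : Finite F := Nat.finite_of_card_ne_zero (by rw [hF]; positivity)
  have := Fintype.ofFinite F
  have := Fintype.ofFinite K
  have hKd : ∀ x ∈ K, x ^ 2 ^ d = x := by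
    intro x hx
    have := FiniteField.pow_card (⟨x, hx⟩ : K)
    rw [← Nat.card_eq_fintype_card, hK] at this
    exact congrArg Subtype.val this
  have hset : (K : Set F) = {x : F | x ^ 2 ^ d = x} := by
    apply Set.eq_of_subset_of_ncard_le (fun x hx => hKd x hx)
    refine (ncard_pow_two_pow_eq_le hd0).trans ?_
    rw [← hK]
    exact le_rfl
  rw [iterateFrobenius_def]
  constructor
  · intro hx
    obtain ⟨l', hl'⟩ : d ∣ l := by rw [hd]; exact Nat.gcd_dvd_left _ _
    rw [hl', mul_comm]
    exact pow_two_pow_mul (hKd x hx) l'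
  · intro hx
    have hx' : x ^ 2 ^ (n * d) = x := by
      rw [← hF, Nat.card_eq_fintype_card, FiniteField.pow_card]
    have := pow_two_pow_gcd hx hx'
    rw [← hd] at this
    have h2 : x ∈ (K : Set F) := by rw [hset]; exact this
    exact h2

/-- If `σ^i = σ^j` with `i < j < n`, all of `F` is fixed by a Frobenius power whose exponent divides
`(j - i) * d < n * d`, too small for `|F|`. The powers are thus distinct and Dedekind's theorem
applies. -/
lemma frobPow_independent (hn : 1 < n) (hd0 : 0 < d) (hd : d = Nat.gcd l (n * d))
    (hF : Nat.card F = 2 ^ (n * d)) (c : ℕ → F)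
    (h : ∀ t : F, ∑ k ∈ Finset.range n, (frobPow F l ^ k) t * c k = 0) : ∀ k < n, c k = 0 := by
  have hfin : Finite F := Nat.finite_of_card_ne_zero (by rw [hF]; positivity)
  have := Fintype.ofFinite F
  have hlt : ∀ i j : ℕ, i < j → j < n → (frobPow F l ^ i) ≠ (frobPow F l ^ j) := by
    intro i j hij hj heq
    have hx : ∀ x : F, x ^ 2 ^ Nat.gcd ((j - i) * l) (n * d) = x := by
      intro x
      apply pow_two_pow_gcd
      · rw [← frobPow_pow_apply]
        apply (frobPow F l ^ i).injective
        rw [RingHom.pow_add_apply, show i + (j - i) = j by omega, heq]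
      · rw [← hF, Nat.card_eq_fintype_card, FiniteField.pow_card]
    set g := Nat.gcd ((j - i) * l) (n * d) with hg
    have hg0 : 0 < g := Nat.gcd_pos_of_pos_right _ (by positivity)
    have h1 := ncard_pow_two_pow_eq_le (F := F) hg0
    have h2 : {x : F | x ^ 2 ^ g = x} = Set.univ := Set.eq_univ_of_forall hx
    rw [h2, Set.ncard_univ, hF] at h1
    have h3 : n * d ≤ g := (Nat.pow_le_pow_iff_right one_lt_two).mp h1
    have h4 : g ∣ (j - i) * d := by
      have : (j - i) * d = Nat.gcd ((j - i) * l) ((j - i) * (n * d)) := by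
        rw [Nat.gcd_mul_left, ← hd]
      rw [this]
      exact Nat.dvd_gcd (Nat.gcd_dvd_left _ _) ((Nat.gcd_dvd_right _ _).trans (Dvd.intro_left _ rfl))
    have h5 := Nat.le_of_dvd (Nat.mul_pos (by omega) hd0) h4
    have h6 : n * d ≤ (j - i) * d := h3.trans h5
    have := Nat.le_of_mul_le_mul_right h6 hd0
    omega
  have hinj : Function.Injective fun k : Fin n => ((frobPow F l ^ (k : ℕ) : F →+* F) : F →* F) := by
    intro i j hij
    have hij' : frobPow F l ^ (i : ℕ) = frobPow F l ^ (j : ℕ) :=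
      RingHom.ext fun x => DFunLike.congr_fun hij x
    rcases lt_trichotomy (i : ℕ) j with h | h | h
    · exact absurd hij' (hlt _ _ h j.2)
    · exact Fin.ext h
    · exact absurd hij'.symm (hlt _ _ h i.2)
  have hli := (linearIndependent_monoidHom F F).comp _ hinj
  rw [Fintype.linearIndependent_iff] at hli
  intro k hk
  refine hli (fun k => c k) ?_ ⟨k, hk⟩
  funext t
  have := h t
  rw [Finset.sum_range] at this
  simp only [Finset.sum_apply, Pi.smul_apply, Function.comp, smul_eq_mul, Pi.zero_apply]
  rw [← this]
  exact Finset.sum_congr rfl fun i _ => mul_comm _ _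

/-- Writing `l = d * l'` with `l'` coprime to `n`, multiplication by `l'` permutes the residues mod
`n`, and exponents of Frobenius matter only mod `n * d`. -/
lemma trGF_eq (hn : 1 < n) (hd0 : 0 < d) (hd : d = Nat.gcd l (n * d))
    (hF : Nat.card F = 2 ^ (n * d)) (v : F) :
    trGF d (n * d) v = ∑ j ∈ Finset.range n, (frobPow F l ^ (j + 1)) v := by
  have hfin : Finite F := Nat.finite_of_card_ne_zero (by rw [hF]; positivity)
  have := Fintype.ofFinite F
  have hv : v ^ 2 ^ (n * d) = v := by
    rw [← hF, Nat.card_eq_fintype_card, FiniteField.pow_card]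
  obtain ⟨l', hl'⟩ : d ∣ l := by rw [hd]; exact Nat.gcd_dvd_left _ _
  have hcop : Nat.Coprime n l' := by
    rw [hl', mul_comm n d, Nat.gcd_mul_left] at hd
    have := Nat.eq_of_mul_eq_mul_left hd0 ((mul_one d).trans hd)
    exact (Nat.coprime_comm.mp this.symm)
  rw [trGF, Nat.mul_div_cancel _ hd0]
  symm
  have hmap : Set.InjOn (fun j => l' * (j + 1) % n) (Finset.range n : Set ℕ) := by
    intro i hi j hj hij
    have hi := Finset.mem_range.mp hi
    have hj := Finset.mem_range.mp hj
    have h1 : i + 1 ≡ j + 1 [MOD n] := Nat.ModEq.cancel_left_of_coprime hcop hij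
    have h2 : i ≡ j [MOD n] := Nat.ModEq.add_right_cancel' 1 h1
    exact Nat.ModEq.eq_of_lt_of_lt h2 hi hj
  have hmaps : Set.MapsTo (fun j => l' * (j + 1) % n) (Finset.range n : Set ℕ) (Finset.range n : Set ℕ) :=
    fun j _ => Finset.mem_coe.mpr (Finset.mem_range.mpr (Nat.mod_lt _ (by omega)))
  refine Finset.sum_nbij (fun j => l' * (j + 1) % n) hmaps hmap
    (Finset.surjOn_of_injOn_of_card_le _ hmaps hmap le_rfl) ?_
  intro j _
  rw [frobPow_pow_apply, hl', show (j + 1) * (d * l') = (l' * (j + 1)) * d by ring]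
  conv_lhs => rw [← Nat.div_add_mod (l' * (j + 1)) n, add_mul, pow_add, pow_mul,
    show n * (l' * (j + 1) / n) * d = (l' * (j + 1) / n) * (n * d) by ring, pow_two_pow_mul hv]

end Setup

/-! ### Multiplicity of the zeros -/

section Multiplicity

variable {F : Type*} [Field F] [CharP F 2]

/-- The polynomial whose `2 ^ l`-th power is `polyC F l i`. -/
noncomputable def rootPolyC (F : Type*) [Field F] (l : ℕ) : ℕ → F[X]
  | 0 => 0
  | 1 => 1
  | 2 => 1
  | i + 3 => rootPolyC F l (i + 2) + X ^ 2 ^ (i * l) * rootPolyC F l (i + 1)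

omit [CharP F 2] in
lemma rootPolyC_add_three (l i : ℕ) :
    rootPolyC F l (i + 3) = rootPolyC F l (i + 2) + X ^ 2 ^ (i * l) * rootPolyC F l (i + 1) := rfl

omit [CharP F 2] in
lemma polyC_add_three (l i : ℕ) :
    polyC F l (i + 3) = polyC F l (i + 2) + X ^ 2 ^ ((i + 1) * l) * polyC F l (i + 1) := rfl

lemma polyC_eq_pow (l i : ℕ) : polyC F l i = rootPolyC F l i ^ 2 ^ l := by
  induction i using Nat.strong_induction_on with
  | _ i ih =>
    match i with
    | 0 => simp [polyC, rootPolyC]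
    | 1 => simp [polyC, rootPolyC]
    | 2 => simp [polyC, rootPolyC]
    | i + 3 =>
      rw [polyC_add_three, rootPolyC_add_three, add_pow_char_pow, mul_pow, ← pow_mul, ← pow_add,
        ih (i + 2) (by omega), ih (i + 1) (by omega), add_mul, one_mul]

lemma derivative_X_pow_two_pow {m : ℕ} (hm : m ≠ 0) : derivative (X ^ 2 ^ m : F[X]) = 0 := by
  rw [derivative_X_pow, Nat.cast_pow, Nat.cast_ofNat, CharTwo.two_eq_zero, zero_pow hm, C_0, zero_mul]

/-- Only the first power `X ^ 2 ^ 0` has nonzero derivative, so differentiating strips the first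
variable of the continuant and leaves a Frobenius twist of an earlier one. -/
lemma derivative_rootPolyC {l : ℕ} (hl : l ≠ 0) (i : ℕ) :
    derivative (rootPolyC F l (i + 2)) = rootPolyC F l i ^ 2 ^ (2 * l) := by
  induction i using Nat.strong_induction_on with
  | _ i ih =>
    match i with
    | 0 => simp [rootPolyC]
    | 1 => simp [rootPolyC]
    | 2 =>
      rw [rootPolyC_add_three, derivative_add, derivative_mul,
        derivative_X_pow_two_pow (by simpa using hl)]
      simp [rootPolyC]
    | i + 3 =>
      rw [rootPolyC_add_three l (i + 2), derivative_add, derivative_mul,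
        derivative_X_pow_two_pow (Nat.mul_ne_zero (by omega) hl), ih (i + 2) (by omega),
        ih (i + 1) (by omega), rootPolyC_add_three l i, add_pow_char_pow, mul_pow, ← pow_mul,
        ← pow_add, zero_mul, zero_add, add_mul]

omit [CharP F 2] in
lemma twistedSeq_ne_zero_or (σ : F →+* F) (a : F) (i : ℕ) :
    twistedSeq σ a i ≠ 0 ∨ twistedSeq σ a (i + 1) ≠ 0 := by
  induction i with
  | zero => exact Or.inr one_ne_zero
  | succ i ih =>
    by_contra! h
    obtain ⟨h1, h2⟩ := h
    rw [twistedSeq_add_two, h1, zero_add, mul_eq_zero] at h2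
    rcases h2 with h2 | h2
    · rw [(map_eq_zero _).mp h2, twistedSeq_zero_succ] at h1
      exact one_ne_zero h1
    · exact ih.elim (· h2) (· h1)

lemma polyC_ne_zero (l i : ℕ) : polyC F l (i + 1) ≠ 0 := by
  intro h
  have h1 := eval_polyC l (i + 1) (0 : F)
  rw [h, eval_zero, twistedSeq_zero_succ] at h1
  exact zero_ne_one h1

lemma rootPolyC_ne_zero (l i : ℕ) : rootPolyC F l (i + 1) ≠ 0 := by
  intro h
  apply polyC_ne_zero (F := F) l i
  rw [polyC_eq_pow, h, zero_pow (by positivity)]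

lemma rootMultiplicity_polyC {l : ℕ} (hl : l ≠ 0) (m : ℕ) {x : F}
    (hx : (polyC F l (m + 2)).IsRoot x) : (polyC F l (m + 2)).rootMultiplicity x = 2 ^ l := by
  classical
  have hD : rootPolyC F l (m + 2) ≠ 0 := rootPolyC_ne_zero l (m + 1)
  have hiff : ∀ i, (rootPolyC F l i).eval x = 0 ↔ twistedSeq (frobPow F l) x i = 0 := by
    intro i
    rw [← eval_polyC, polyC_eq_pow, eval_pow, pow_eq_zero_iff (by positivity)]
  have hx' : twistedSeq (frobPow F l) x (m + 2) = 0 := by rw [← eval_polyC]; exact hx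
  have hroot : (rootPolyC F l (m + 2)).IsRoot x := (hiff _).mpr hx'
  have h1 : (rootPolyC F l (m + 2)).rootMultiplicity x = 1 := by
    apply le_antisymm
    · by_contra! h
      have h2 := ((one_lt_rootMultiplicity_iff_isRoot hD).mp h).2
      rw [derivative_rootPolyC hl, IsRoot.def, eval_pow, pow_eq_zero_iff (by positivity), hiff] at h2
      have h3 := hx'
      rw [twistedSeq_add_two, h2, mul_zero, add_zero] at h3
      -- A double root would kill `C_m` and `C_{m+2}`, hence also `C_{m+1}`: two consecutive zeros.
      exact (twistedSeq_ne_zero_or _ x m).elim (· h2) (· h3)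
    · exact (rootMultiplicity_pos hD).mpr hroot
  rw [polyC_eq_pow, ← count_roots, roots_pow, Multiset.count_nsmul, count_roots, h1, mul_one]

end Multiplicity

/-! ### Degree and splitting -/

section Degree

/-- The number `t ^ (n - 3) + t ^ (n - 5) + ⋯`, with last term `1` or `t`. -/
def altGeom (t : ℕ) : ℕ → ℕ
  | 0 => 0
  | 1 => 0
  | 2 => 0
  | i + 3 => t ^ i + altGeom t (i + 1)

lemma altGeom_add_three (t i : ℕ) : altGeom t (i + 3) = t ^ i + altGeom t (i + 1) := rfl

lemma altGeom_mono {t u : ℕ} (h : t ≤ u) (n : ℕ) : altGeom t n ≤ altGeom u n := by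
  induction n using Nat.strong_induction_on with
  | _ n ih =>
    match n with
    | 0 | 1 | 2 => exact le_rfl
    | n + 3 => exact add_le_add (Nat.pow_le_pow_left h n) (ih (n + 1) (by omega))

lemma altGeom_lt {t u : ℕ} (h : t < u) {n : ℕ} (hn : 4 ≤ n) : altGeom t n < altGeom u n := by
  obtain ⟨m, rfl⟩ : ∃ m, n = m + 1 + 3 := ⟨n - 4, by omega⟩
  exact add_lt_add_of_lt_of_le (Nat.pow_lt_pow_left h (by omega)) (altGeom_mono h.le _)

lemma altGeom_eq_of_lt_four (t u : ℕ) {n : ℕ} (hn : n < 4) : altGeom t n = altGeom u n := by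
  interval_cases n <;> simp [altGeom]

lemma altGeom_mul_add (t : ℕ) (ht : 0 < t) (n : ℕ) (hn : 0 < n) :
    altGeom t n * (t ^ 2 - 1) + (if Odd n then 1 else t) = t ^ (n - 1) := by
  obtain ⟨c, hc⟩ : ∃ c, t ^ 2 = c + 1 := ⟨t ^ 2 - 1, by have := pow_pos ht 2; omega⟩
  rw [hc, Nat.add_sub_cancel]
  induction n using Nat.strong_induction_on with
  | _ n ih =>
    match n with
    | 0 => omega
    | 1 => simp [altGeom]
    | 2 => simp [altGeom, show ¬ Odd 2 by decide]
    | n + 3 =>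
      have h := ih (n + 1) (by omega) (by omega)
      have hodd : Odd (n + 3) ↔ Odd (n + 1) := by simp [Nat.odd_add]; grind
      simp only [hodd]
      rw [altGeom_add_three, add_mul, add_assoc, h, show n + 3 - 1 = n + 2 by omega, pow_add, hc,
        Nat.add_sub_cancel]
      ring

/-- This bound makes the second summand of the recursion strictly dominate in degree, ruling out
cancellation of leading terms. -/
lemma mul_altGeom_lt {t : ℕ} (ht : 2 ≤ t) (i : ℕ) : t * altGeom t (i + 1) < t ^ i := by
  induction i using Nat.strong_induction_on with
  | _ i ih =>
    match i with
    | 0 => simp [altGeom]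
    | 1 => simp [altGeom]; omega
    | i + 2 =>
      have h := ih i (by omega)
      rw [altGeom_add_three, mul_add, ← pow_succ']
      have h1 : t ^ (i + 2) = t * t ^ (i + 1) := pow_succ' t (i + 1)
      have h2 : t ^ (i + 1) = t * t ^ i := pow_succ' t i
      have h3 : 2 * t ^ (i + 1) ≤ t * t ^ (i + 1) := Nat.mul_le_mul_right _ ht
      have h4 : 2 * t ^ i ≤ t * t ^ i := Nat.mul_le_mul_right _ ht
      omega

variable {F : Type*} [Field F] [CharP F 2]

lemma natDegree_polyC {l : ℕ} (hl : l ≠ 0) (i : ℕ) :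
    (polyC F l (i + 1)).natDegree = 2 ^ l * altGeom (2 ^ l) (i + 1) := by
  have hq : 2 ≤ 2 ^ l := Nat.one_lt_two_pow hl
  induction i using Nat.strong_induction_on with
  | _ i ih =>
    match i with
    | 0 => simp [polyC, altGeom]
    | 1 => simp [polyC, altGeom]
    | i + 2 =>
      have h1 := ih (i + 1) (by omega)
      have h0 := ih i (by omega)
      have hm : (X ^ 2 ^ ((i + 1) * l) * polyC F l (i + 1)).natDegree =
          (2 ^ l) ^ (i + 1) + 2 ^ l * altGeom (2 ^ l) (i + 1) := by
        rw [natDegree_mul (pow_ne_zero _ X_ne_zero) (polyC_ne_zero l i), natDegree_X_pow, h0,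
          ← pow_mul, mul_comm l]
      have hlt := mul_altGeom_lt hq (i + 1)
      rw [polyC_add_three, natDegree_add_eq_right_of_natDegree_lt (by rw [hm, h1]; omega), hm,
        altGeom_add_three, mul_add, ← pow_succ']

lemma splits_polyC_iff {l : ℕ} (hl : l ≠ 0) (m : ℕ) :
    (polyC F l (m + 2)).Splits ↔
      {x : F | (polyC F l (m + 2)).IsRoot x}.ncard = altGeom (2 ^ l) (m + 2) := by
  classical
  have hne : polyC F l (m + 2) ≠ 0 := polyC_ne_zero l (m + 1)
  have hset : {x : F | (polyC F l (m + 2)).IsRoot x} = ((polyC F l (m + 2)).roots.toFinset : Set F) := by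
    ext x; simp [hne]
  have hcard : (polyC F l (m + 2)).roots.card =
      2 ^ l * {x : F | (polyC F l (m + 2)).IsRoot x}.ncard := by
    rw [hset, Set.ncard_coe_finset, ← Multiset.toFinset_sum_count_eq, mul_comm]
    apply Finset.sum_const_nat
    intro x hx
    rw [count_roots]
    exact rootMultiplicity_polyC hl m (isRoot_of_mem_roots (Multiset.mem_toFinset.mp hx))
  rw [splits_iff_card_roots, hcard, natDegree_polyC hl]
  exact Nat.mul_right_inj (by positivity)

end Degree

/-! ### Elements of trace zero -/

section Trace

variable {F : Type*} [Field F] [CharP F 2] {l n d : ℕ}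

omit [CharP F 2] in
lemma ncard_trGF_eq_zero_le [Finite F] (hn : 0 < n) (hd0 : 0 < d) :
    {v : F | trGF d (n * d) v = 0}.ncard ≤ 2 ^ ((n - 1) * d) := by
  classical
  set p : F[X] := ∑ i ∈ Finset.range n, X ^ 2 ^ (i * d) with hp
  have hne : p ≠ 0 := by
    intro h
    have h1 : p.coeff 1 = 1 := by
      rw [hp, finsetSum_coeff, Finset.sum_eq_single 0]
      · simp
      · intro i _ hi
        rw [coeff_X_pow, if_neg]
        have : 1 < 2 ^ (i * d) := Nat.one_lt_two_pow (Nat.mul_ne_zero hi hd0.ne')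
        omega
      · intro h0
        exact absurd (Finset.mem_range.mpr hn) h0
    rw [h, coeff_zero] at h1
    exact zero_ne_one h1
  have hdeg : p.natDegree ≤ 2 ^ ((n - 1) * d) := by
    refine natDegree_sum_le_of_forall_le _ _ fun i hi => ?_
    rw [natDegree_X_pow]
    have := Finset.mem_range.mp hi
    exact Nat.pow_le_pow_right two_pos (Nat.mul_le_mul_right d (by omega))
  have hsub : {v : F | trGF d (n * d) v = 0} ⊆ (p.roots.toFinset : Set F) := by
    intro x hx
    rw [Set.mem_ofPred_eq, trGF, Nat.mul_div_cancel _ hd0] at hx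
    rw [Finset.mem_coe, Multiset.mem_toFinset, mem_roots hne, IsRoot.def, hp, eval_finsetSum]
    simpa using hx
  calc _ ≤ (p.roots.toFinset : Set F).ncard := Set.ncard_le_ncard hsub
    _ = p.roots.toFinset.card := Set.ncard_coe_finset _
    _ ≤ p.roots.card := Multiset.toFinset_card_le _
    _ ≤ p.natDegree := card_roots' _
    _ ≤ _ := hdeg

/-- Additive Hilbert 90. -/
lemma setOf_trGF_eq_zero (hn : 1 < n) (hd0 : 0 < d) (hd : d = Nat.gcd l (n * d))
    (hF : Nat.card F = 2 ^ (n * d)) (K : Subfield F) (hK : Nat.card K = 2 ^ d) :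
    {v : F | trGF d (n * d) v = 0} = Set.range (fun s => s + frobPow F l s) ∧
      {v : F | trGF d (n * d) v = 0}.ncard = 2 ^ ((n - 1) * d) := by
  have hfin : Finite F := Nat.finite_of_card_ne_zero (by rw [hF]; positivity)
  have h1 := ncard_range_add_map (frobPow F l) K (mem_iff_frobPow_eq hd0 hd hF K hK)
  rw [hF, hK, show n * d = d + (n - 1) * d by
    obtain ⟨m, rfl⟩ : ∃ m, n = m + 1 := ⟨n - 1, by omega⟩
    rw [Nat.add_sub_cancel]; ring, pow_add] at h1
  have h2 := Nat.eq_of_mul_eq_mul_left (by positivity) h1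
  have h3 : Set.range (fun s => s + frobPow F l s) = {v : F | trGF d (n * d) v = 0} := by
    -- The image already has `2 ^ ((n - 1) * d)` elements, the most that the degree of the trace
    -- polynomial allows.
    refine Set.eq_of_subset_of_ncard_le ?_ ?_ (Set.toFinite _)
    · rintro _ ⟨s, rfl⟩
      rw [Set.mem_ofPred_eq, trGF_eq hn hd0 hd hF]
      have e := map_sum_shift (frobPow F l) n (fun j => (frobPow F l ^ (j + 1)) s)
        (fun j => (frobPow F l ^ (j + 1)) s) (fun k _ => RingHom.pow_succ_apply' _ _ _)
        (by rw [← RingHom.pow_succ_apply, frobPow_pow_eq_self hd hF, zero_add, pow_one])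
      rw [map_sum] at e
      simp only [map_add, Finset.sum_add_distrib]
      rw [CharTwo.add_eq_zero, ← e]
      exact Finset.sum_congr rfl fun j _ => by
        rw [RingHom.pow_succ_apply, RingHom.pow_succ_apply']
    · rw [h2]; exact ncard_trGF_eq_zero_le (by omega) hd0
  exact ⟨h3.symm, by rw [← h3, h2]⟩

lemma trGF_eq_natCast_mul (hn : 1 < n) (hd0 : 0 < d) (hd : d = Nat.gcd l (n * d))
    (hF : Nat.card F = 2 ^ (n * d)) {v : F} (hv : frobPow F l v = v) :
    trGF d (n * d) v = n * v := by
  have h : ∀ j, (frobPow F l ^ j) v = v := by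
    intro j
    induction j with
    | zero => rfl
    | succ j ih => rw [← RingHom.pow_succ_apply, hv, ih]
  rw [trGF_eq hn hd0 hd hF]
  simp only [h, Finset.sum_const, Finset.card_range, nsmul_eq_mul]

/-- On `K` the trace is multiplication by `n`, so its zeros there are `{0}` for odd `n` and all of
`K` for even `n`. -/
lemma ncard_trGF_eq_zero_diff (hn : 1 < n) (hd0 : 0 < d) (hd : d = Nat.gcd l (n * d))
    (hF : Nat.card F = 2 ^ (n * d)) (K : Subfield F) (hK : Nat.card K = 2 ^ d) :
    {v : F | v ∉ K ∧ trGF d (n * d) v = 0}.ncard + (if Odd n then 1 else 2 ^ d)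
      = 2 ^ ((n - 1) * d) := by
  have hfin : Finite F := Nat.finite_of_card_ne_zero (by rw [hF]; positivity)
  have hmem := mem_iff_frobPow_eq hd0 hd hF K hK
  rw [← (setOf_trGF_eq_zero hn hd0 hd hF K hK).2,
    ← Set.ncard_inter_add_ncard_sdiff_eq_ncard {v : F | trGF d (n * d) v = 0} K, add_comm]
  congr 1
  · have : {v : F | trGF d (n * d) v = 0} ∩ K = if Odd n then {0} else (K : Set F) := by
      ext v
      rw [Set.mem_inter_iff, Set.mem_ofPred_eq, SetLike.mem_coe]
      split_ifs with ho
      · have h1 : (n : F) = 1 := (CharTwo.natCast_eq_ite n).trans (if_neg (by simpa using ho))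
        constructor
        · rintro ⟨h, hv⟩
          rw [trGF_eq_natCast_mul hn hd0 hd hF ((hmem v).mp hv), h1, one_mul] at h
          exact h
        · rintro rfl
          rw [trGF_eq_natCast_mul hn hd0 hd hF (map_zero _), mul_zero]
          exact ⟨rfl, K.zero_mem⟩
      · have h1 : (n : F) = 0 := (CharTwo.natCast_eq_ite n).trans (if_pos (by simpa using ho))
        constructor
        · exact fun h => h.2
        · intro hv
          rw [trGF_eq_natCast_mul hn hd0 hd hF ((hmem v).mp hv), h1, zero_mul]
          exact ⟨rfl, hv⟩
    rw [this]
    split_ifs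
    · simp
    · rw [← hK]; rfl
  · congr 1
    ext v
    simp [and_comm]

end Trace

/-! ### The zeros of `C_n` and their number -/

section Zeros

variable {F : Type*} [Field F] [CharP F 2] {l n d : ℕ}

lemma add_frobPow_ne_zero_iff (hd0 : 0 < d) (hd : d = Nat.gcd l (n * d))
    (hF : Nat.card F = 2 ^ (n * d)) (K : Subfield F) (hK : Nat.card K = 2 ^ d) (v : F) :
    v + frobPow F l v ≠ 0 ↔ v ∉ K := by
  rw [mem_iff_frobPow_eq hd0 hd hF K hK, ne_eq, CharTwo.add_eq_zero, eq_comm]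

lemma eval_polyC_valV (hn : 1 < n) (hd0 : 0 < d) (hd : d = Nat.gcd l (n * d))
    (hF : Nat.card F = 2 ^ (n * d)) {v : F} (hv : v + frobPow F l v ≠ 0) :
    (polyC F l n).eval (valV l v) =
      trGF d (n * d) v / (frobPow F l v + frobPow F l (frobPow F l v)) *
        ∏ j ∈ Finset.Icc 2 (n - 1), (v / (v + frobPow F l v)) ^ (2 ^ (j * l)) := by
  obtain ⟨m, rfl⟩ : ∃ m, n = m + 2 := ⟨n - 2, by omega⟩
  have hv0 : v ≠ 0 := by rintro rfl; simp at hv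
  have h1 : frobPow F l v ≠ 0 := (_root_.map_ne_zero _).mpr hv0
  have h2 : frobPow F l v + frobPow F l (frobPow F l v) ≠ 0 := by
    rw [← map_add]; exact (_root_.map_ne_zero _).mpr hv
  have key := twistedSeq_twistedV (frobPow F l) hv (m + 1)
  have hprod : ∏ j ∈ Finset.Icc 2 (m + 2 - 1), (v / (v + frobPow F l v)) ^ (2 ^ (j * l)) =
      ∏ j ∈ Finset.range m, (frobPow F l ^ (j + 1 + 1)) (v / (v + frobPow F l v)) := by
    rw [show Finset.Icc 2 (m + 2 - 1) = Finset.Ico 2 (m + 2) by ext; simp; omega,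
      Finset.prod_Ico_eq_prod_range, Nat.add_sub_cancel]
    exact Finset.prod_congr rfl fun j _ => by
      rw [frobPow_pow_apply, show 2 + j = j + 1 + 1 by omega]
  rw [← trGF_eq hn hd0 hd hF, Finset.prod_range_succ', ← hprod, zero_add, pow_one, map_div₀,
    map_add] at key
  rw [eval_polyC, valV_eq]
  apply mul_right_cancel₀ h1
  rw [key]
  field_simp

lemma isRoot_polyC_valV_iff (hn : 1 < n) (hd0 : 0 < d) (hd : d = Nat.gcd l (n * d))
    (hF : Nat.card F = 2 ^ (n * d)) {v : F} (hv : v + frobPow F l v ≠ 0) :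
    (polyC F l n).IsRoot (valV l v) ↔ trGF d (n * d) v = 0 := by
  have hv0 : v ≠ 0 := by rintro rfl; simp at hv
  have h2 : frobPow F l v + frobPow F l (frobPow F l v) ≠ 0 := by
    rw [← map_add]; exact (_root_.map_ne_zero _).mpr hv
  rw [IsRoot.def, eval_polyC_valV hn hd0 hd hF hv, mul_eq_zero, div_eq_zero_iff]
  have h3 : ∏ j ∈ Finset.Icc 2 (n - 1), (v / (v + frobPow F l v)) ^ (2 ^ (j * l)) ≠ 0 :=
    Finset.prod_ne_zero_iff.mpr fun j _ => pow_ne_zero _ (div_ne_zero hv0 hv)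
  simp only [h2, h3, or_false]

lemma exists_valV_eq_of_isRoot (hn : 1 < n) (hd0 : 0 < d) (hd : d = Nat.gcd l (n * d))
    (hF : Nat.card F = 2 ^ (n * d)) {x : F} (hx : (polyC F l n).IsRoot x) :
    ∃ v : F, v + frobPow F l v ≠ 0 ∧ valV l v = x := by
  have hfin : Finite F := Nat.finite_of_card_ne_zero (by rw [hF]; positivity)
  rw [IsRoot.def, eval_polyC] at hx
  have hx0 : x ≠ 0 := by
    rintro rfl
    obtain ⟨m, rfl⟩ : ∃ m, n = m + 1 := ⟨n - 1, by omega⟩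
    rw [twistedSeq_zero_succ] at hx
    exact one_ne_zero hx
  obtain ⟨b, hb⟩ := (Finite.injective_iff_surjective.mp (CharTwo.sq_injective (R := F))) x
  simp only at hb
  subst hb
  have hb0 : b ≠ 0 := by rintro rfl; simp at hx0
  obtain ⟨v, hv, e⟩ := exists_twistedV_eq (frobPow F l) (by omega : 0 < n)
    (frobPow_pow_eq_self hd hF) (frobPow_independent hn hd0 hd hF) hb0 hx
  exact ⟨v, hv, by rw [valV_eq, e]⟩

lemma isRoot_polyC_iff (hn : 1 < n) (hd0 : 0 < d) (hd : d = Nat.gcd l (n * d))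
    (hF : Nat.card F = 2 ^ (n * d)) (K : Subfield F) (hK : Nat.card K = 2 ^ d) (x : F) :
    (polyC F l n).IsRoot x ↔ ∃ v : F, v ∉ K ∧ trGF d (n * d) v = 0 ∧ x = valV l v := by
  have hKv := add_frobPow_ne_zero_iff hd0 hd hF K hK
  constructor
  · intro hx
    obtain ⟨v, hv, rfl⟩ := exists_valV_eq_of_isRoot hn hd0 hd hF hx
    exact ⟨v, (hKv v).mp hv, (isRoot_polyC_valV_iff hn hd0 hd hF hv).mp hx, rfl⟩
  · rintro ⟨v, hv, ht, rfl⟩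
    exact (isRoot_polyC_valV_iff hn hd0 hd hF ((hKv v).mpr hv)).mpr ht

/-- Vanishing of the trace depends only on `V(v)`, so the trace-zero elements outside `K` are a
union of full fibres of `V`, one over each zero. -/
lemma ncard_trGF_eq_ncard_roots_mul (hn : 1 < n) (hd0 : 0 < d) (hd : d = Nat.gcd l (n * d))
    (hF : Nat.card F = 2 ^ (n * d)) (K : Subfield F) (hK : Nat.card K = 2 ^ d) :
    {v : F | v ∉ K ∧ trGF d (n * d) v = 0}.ncard =
      {x : F | (polyC F l n).IsRoot x}.ncard * ((2 ^ d) ^ 2 - 1) := by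
  classical
  have hfin : Finite F := Nat.finite_of_card_ne_zero (by rw [hF]; positivity)
  have := Fintype.ofFinite F
  have hKv := add_frobPow_ne_zero_iff hd0 hd hF K hK
  rw [Set.ncard_eq_toFinset_card', Set.ncard_eq_toFinset_card',
    Finset.card_eq_sum_card_fiberwise (f := valV l)
      (t := {x : F | (polyC F l n).IsRoot x}.toFinset), Finset.sum_const_nat]
  · intro x hx
    rw [Set.mem_toFinset, Set.mem_ofPred_eq] at hx
    obtain ⟨v, hv, ht, rfl⟩ := (isRoot_polyC_iff hn hd0 hd hF K hK x).mp hx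
    have hv' := (hKv v).mpr hv
    have hts : v ∈ {v : F | trGF d (n * d) v = 0} := ht
    rw [(setOf_trGF_eq_zero hn hd0 hd hF K hK).1] at hts
    obtain ⟨s, hs⟩ := hts
    simp only at hs
    rw [← hs] at hv' hv
    have hs0 : s + frobPow F l s ≠ 0 := by
      intro h0; rw [h0] at hv'; simp at hv'
    rw [← hK, ← ncard_fibre_twistedV (frobPow F l) K (mem_iff_frobPow_eq hd0 hd hF K hK) hs0 hv',
      Set.ncard_eq_toFinset_card', hs]
    congr 1
    ext u
    simp only [Finset.mem_filter, Set.mem_toFinset, Set.mem_ofPred_eq, ← valV_eq]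
    constructor
    · rintro ⟨⟨h1, _⟩, h3⟩
      exact ⟨(hKv u).mpr h1, h3⟩
    · rintro ⟨h1, h3⟩
      refine ⟨⟨(hKv u).mp h1, ?_⟩, h3⟩
      rw [← isRoot_polyC_valV_iff hn hd0 hd hF h1, h3]
      exact hx
  · intro v hv
    rw [Set.coe_toFinset, Set.mem_ofPred_eq] at hv ⊢
    exact (isRoot_polyC_iff hn hd0 hd hF K hK _).mpr ⟨v, hv.1, hv.2, rfl⟩

end Zeros

/-! ### Values, zeros, multiplicities and splitting of `C_n` -/

theorem mainTheorem6 {F : Type*} [Field F] (l n d : ℕ) (hn : 1 < n)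
    (hd : d = Nat.gcd l (n * d)) (hF : Nat.card F = 2 ^ (n * d))
    (K : Subfield F) (hK : Nat.card K = 2 ^ d) :
    -- the value of `C_n` at `V` (with all denominators nonzero)
    (∀ v : F, v ∉ K →
      conj2 l 0 v + conj2 l 1 v ≠ 0 ∧ conj2 l 1 v + conj2 l 2 v ≠ 0 ∧
      (polyC F l n).eval (valV l v) =
        trGF d (n * d) (conj2 l 0 v) / (conj2 l 1 v + conj2 l 2 v) *
          ∏ j ∈ Finset.Icc 2 (n - 1),
            (conj2 l 0 v / (conj2 l 0 v + conj2 l 1 v)) ^ (2 ^ (j * l))) ∧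
    -- the number of distinct zeros
    (Odd n → ({x : F | (polyC F l n).IsRoot x}.ncard : ℚ) =
      (2 ^ ((n - 1) * d) - 1) / (2 ^ (2 * d) - 1)) ∧
    (Even n → ({x : F | (polyC F l n).IsRoot x}.ncard : ℚ) =
      (2 ^ ((n - 1) * d) - 2 ^ d) / (2 ^ (2 * d) - 1)) ∧
    -- the zeros are exactly the `V` with trace-zero `v_0`
    (∀ x : F, (polyC F l n).IsRoot x ↔
      ∃ v : F, v ∉ K ∧ trGF d (n * d) (conj2 l 0 v) = 0 ∧ x = valV l v) ∧
    -- multiplicities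
    (∀ x : F, (polyC F l n).IsRoot x → (polyC F l n).rootMultiplicity x = 2 ^ l) ∧
    -- splitting
    ((polyC F l n).Splits ↔ d = l ∨ n < 4) := by
  have hn0 : 0 < n := by omega
  -- The gcd condition alone allows `d = 0`, but then `F` would have one element.
  have hd0 : 0 < d := by
    rcases Nat.eq_zero_or_pos d with rfl | h
    · rw [mul_zero, pow_zero] at hF
      have := (Nat.card_eq_one_iff_unique.mp hF).1
      exact absurd (Subsingleton.elim (0 : F) 1) zero_ne_one
    · exact h
  have hl : l ≠ 0 := by
    rintro rfl
    rw [Nat.gcd_zero_left] at hd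
    have : 2 * d ≤ n * d := Nat.mul_le_mul_right d hn
    omega
  have hfin : Finite F := Nat.finite_of_card_ne_zero (by rw [hF]; positivity)
  have : Fintype F := Fintype.ofFinite F
  have : CharP F 2 := by
    have : Fact (Nat.Prime 2) := ⟨Nat.prime_two⟩
    exact charP_of_card_eq_prime_pow (f := n * d) (by rwa [Nat.card_eq_fintype_card] at hF)
  have hKv := add_frobPow_ne_zero_iff hd0 hd hF K hK
  have hdl : d ≤ l := Nat.le_of_dvd (Nat.pos_of_ne_zero hl) (hd ▸ Nat.gcd_dvd_left l (n * d))
  have hQ : 1 < (2 ^ d) ^ 2 := Nat.one_lt_pow two_ne_zero (Nat.one_lt_two_pow hd0.ne')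
  have hcount : {x : F | (polyC F l n).IsRoot x}.ncard * ((2 ^ d) ^ 2 - 1) +
      (if Odd n then 1 else 2 ^ d) = (2 ^ d) ^ (n - 1) := by
    rw [← ncard_trGF_eq_ncard_roots_mul hn hd0 hd hF K hK,
      ncard_trGF_eq_zero_diff hn hd0 hd hF K hK, ← pow_mul, mul_comm]
  have hcard : {x : F | (polyC F l n).IsRoot x}.ncard = altGeom (2 ^ d) n :=
    Nat.eq_of_mul_eq_mul_right (Nat.sub_pos_of_lt hQ)
      (Nat.add_right_cancel (hcount.trans (altGeom_mul_add (2 ^ d) (by positivity) n hn0).symm))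
  have hcountQ : (({x : F | (polyC F l n).IsRoot x}.ncard : ℕ) : ℚ) * (2 ^ (2 * d) - 1) +
      (if Odd n then 1 else 2 ^ d) = 2 ^ ((n - 1) * d) := by
    have h := congrArg (Nat.cast : ℕ → ℚ) hcount
    push_cast [Nat.cast_sub hQ.le] at h
    rw [← pow_mul, ← pow_mul, mul_comm d, mul_comm d] at h
    exact h
  have hQQ : (2 ^ (2 * d) - 1 : ℚ) ≠ 0 :=
    sub_ne_zero.mpr (one_lt_pow₀ one_lt_two (by omega)).ne'
  simp only [conj2_zero_eq]
  refine ⟨?_, ?_, ?_, isRoot_polyC_iff hn hd0 hd hF K hK, ?_, ?_⟩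
  · intro v hv
    have hv' := (hKv v).mpr hv
    have e1 : conj2 l 1 v = frobPow F l v := by rw [conj2_eq, pow_one]
    have e2 : conj2 l 2 v = frobPow F l (frobPow F l v) := by rw [conj2_eq]; rfl
    rw [e1, e2]
    refine ⟨hv', ?_, eval_polyC_valV hn hd0 hd hF hv'⟩
    rw [← map_add]
    exact (_root_.map_ne_zero _).mpr hv'
  · intro ho
    rw [if_pos ho] at hcountQ
    rw [eq_div_iff hQQ, ← hcountQ, add_sub_cancel_right]
  · intro he
    rw [if_neg (Nat.not_odd_iff_even.mpr he)] at hcountQ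
    rw [eq_div_iff hQQ, ← hcountQ, add_sub_cancel_right]
  · intro x hx
    obtain ⟨m, rfl⟩ : ∃ m, n = m + 2 := ⟨n - 2, by omega⟩
    exact rootMultiplicity_polyC hl m hx
  · have hsplit : (polyC F l n).Splits ↔
        {x : F | (polyC F l n).IsRoot x}.ncard = altGeom (2 ^ l) n := by
      obtain ⟨m, rfl⟩ : ∃ m, n = m + 2 := ⟨n - 2, by omega⟩
      exact splits_polyC_iff hl m
    rw [hsplit, hcard]
    constructor
    · intro h
      by_contra! hne
      -- For `n ≥ 4` the leading exponent `n - 3` is positive, so `altGeom` is strictly increasing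
      -- in its base.
      have hlt : 2 ^ d < 2 ^ l := Nat.pow_lt_pow_right one_lt_two (lt_of_le_of_ne hdl hne.1)
      exact (altGeom_lt hlt hne.2).ne h
    · rintro (rfl | h)
      · rfl
      · exact altGeom_eq_of_lt_four _ _ h
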